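/- Corollary (depth $1$ Landen connection formula). An index is a tuple $\boldsymbol{k}=(k_1,\dots,k_r)$ of positive integers; its weight is $\mathrm{wt}(\boldsymbol{k})=k_1+\cdots+k_r$. For a non-empty index $\boldsymbol{k}$ and a complex number $z$ with $|z|<1$, let \[ \mathrm{Li}_{\boldsymbol{k}}(z)=\sum_{0=m_0<m_1<\cdots<m_r}\ \prod_{i=1}^r\frac{z^{m_i-m_{i-1}}}{m_i^{k_i}}=\sum_{0<m_1<\cdots<m_r}\frac{z^{m_r}}{m_1^{k_1}\cdots m_r^{k_r}} \] be the one-variable multiple polylogarithm. Let $k$ be a positive integer and let $z$ be a complex number with $|z|<1$ and $\mathrm{Re}(z)<\frac12$ (so that $\left|\frac{z}{z-1}\right|<1$). Then all the series below converge absolutely and \[ \mathrm{Li}_k(z)=-\sum_{\mathrm{wt}(\boldsymbol{k})=k}\mathrm{Li}_{\boldsymbol{k}}\!\left(\frac{z}{z-1}\right), \] where $\boldsymbol{k}$ runs over all (finitely many) indices of weight $k$ and $\mathrm{Li}_k=\mathrm{Li}_{(k)}$. -/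

import Mathlib

/-- The summation range `0 < m₁ < ⋯ < m_r` of depth `r` multiple polylogarithms. -/
abbrev MPLRange (r : ℕ) : Type :=
  {m : Fin r → ℕ // (∀ i, 0 < m i) ∧ StrictMono m}

/-- The `m`-th term `∏ i, z_i ^ (m_i - m_{i-1}) / m_i ^ k_i` (with `m_0 = 0`) of the shuffle-type
multiple polylogarithm. The subtraction is never truncated, as `m` is increasing. -/
noncomputable def mplTerm {r : ℕ} (k : Fin r → ℕ) (z : Fin r → ℂ) (m : MPLRange r) : ℂ :=
  ∏ i : Fin r,
    z i ^ (m.1 i - (Fin.cons 0 m.1 : Fin (r + 1) → ℕ) i.castSucc) / (m.1 i : ℂ) ^ k i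

/-- The shuffle-type multiple polylogarithm of the index `k = (k_1, …, k_r)` at
`(z_1, …, z_r)`. -/
noncomputable def mpl {r : ℕ} (k : Fin r → ℕ) (z : Fin r → ℂ) : ℂ :=
  ∑' m : MPLRange r, mplTerm k z m

/-- The terms of the one-variable multiple polylogarithm, all arguments being equal to `z`. -/
noncomputable def polylogTerm {r : ℕ} (k : Fin r → ℕ) (z : ℂ) (m : MPLRange r) : ℂ :=
  mplTerm k (fun _ => z) m

/-- The one-variable multiple polylogarithm `Li_k(z)`, that is, the shuffle-type multiple
polylogarithm of the index `k` at `(z, …, z)`. -/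
noncomputable def polylog {r : ℕ} (k : Fin r → ℕ) (z : ℂ) : ℂ :=
  mpl k (fun _ => z)

/-- The terms of `Li_k(z)` are `z ^ m_r / (m_1 ^ k_1 ⋯ m_r ^ k_r)`. -/
theorem polylogTerm_eq {r : ℕ} (k : Fin (r + 1) → ℕ) (z : ℂ) (m : MPLRange (r + 1)) :
    polylogTerm k z m = z ^ m.1 (Fin.last r) / ∏ i, (m.1 i : ℂ) ^ k i := by
  unfold polylogTerm mplTerm
  rw [Finset.prod_div_distrib, Finset.prod_pow_eq_pow_sum]
  congr 2
  obtain ⟨m, -, hm⟩ := m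
  have key : ∀ s : ℕ, ∀ f : Fin (s + 1) → ℕ, StrictMono f →
      ∑ i : Fin (s + 1), (f i - (Fin.cons 0 f : Fin (s + 2) → ℕ) i.castSucc) = f (Fin.last s) := by
    intro s
    induction s with
    | zero => intro f _; simp
    | succ s ih =>
      intro f hf
      have h1 := ih (fun i => f i.castSucc) (fun a b h => hf (Fin.castSucc_lt_castSucc_iff.2 h))
      rw [Fin.sum_univ_castSucc]
      have h2 : ∀ i : Fin (s + 1),
          (Fin.cons 0 f : Fin (s + 3) → ℕ) i.castSucc.castSucc =
          (Fin.cons 0 (fun i => f i.castSucc) : Fin (s + 2) → ℕ) i.castSucc := by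
        intro i
        refine Fin.cases ?_ (fun j => ?_) i
        · simp
        · rfl
      simp only [h2]
      rw [h1]
      have h3 : (Fin.cons 0 f : Fin (s + 3) → ℕ) (Fin.last (s + 1)).castSucc
          = f (Fin.last s).castSucc := rfl
      rw [h3]
      have h4 : f (Fin.last s).castSucc < f (Fin.last (s + 1)) := hf (Fin.castSucc_lt_last _)
      omega
  exact key r m hm

/-! Grouping terms by the largest entry `n = m_r` makes each multiple polylogarithm a power series
with coefficients in `[0, 1]`. Summed over all compositions of `k ≥ 1`, the coefficients become
`landenCoeff k n`, because compositions of `k + 1` arise from those of `k` by adding a block `1` or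
enlarging an end block (`sum_multHarmonic`). Let `F_k` be the resulting series (`landenSeries k`).
The recursion for its coefficients says `(1 - w) w F_{k+1}'(w) = F_k(w)`
(`one_sub_mul_tsum_landenCoeff`), and `w = z / (z - 1)` satisfies `z dw/dz = (1 - w) w`. So `z d/dz`
sends `F_{k+1}(w(z))` to `F_k(w(z))`, just as it sends `Li_{k+1}` to `Li_k`. Induction shows that
`Li_k(z) + F_k(w(z))` vanishes: it does at `k = 0`, where it is `z / (1 - z) + w`, and each later
sum has zero derivative and is zero at the origin. -/

/-! ### Summation ranges fibred over the largest entry -/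

/-- The largest entry `m_r` of an element of the summation range, with `m_0 = 0`. -/
def MPLRange.top : {r : ℕ} → MPLRange r → ℕ
  | 0, _ => 0
  | r + 1, m => m.1 (Fin.last r)

theorem MPLRange.le_top {r : ℕ} (m : MPLRange r) (i : Fin r) : m.1 i ≤ m.top := by
  cases r with
  | zero => exact i.elim0
  | succ r => exact m.2.2.monotone (Fin.le_last i)

/-- Forget the largest entry. -/
def MPLRange.init {r : ℕ} (m : MPLRange (r + 1)) : MPLRange r :=
  ⟨Fin.init m.1, fun i => m.2.1 i.castSucc, fun _ _ h => m.2.2 (Fin.castSucc_lt_castSucc_iff.2 h)⟩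

/-- Add a new largest entry. -/
def MPLRange.snoc {r : ℕ} (m : MPLRange r) (n : ℕ) (h : m.top < n) : MPLRange (r + 1) :=
  ⟨Fin.snoc (α := fun _ => ℕ) m.1 n, by
    refine Fin.lastCases ?_ fun i => ?_
    · simpa using Nat.zero_lt_of_lt h
    · simpa using m.2.1 i, by
    intro i j hij
    induction j using Fin.lastCases with
    | last =>
      induction i using Fin.lastCases with
      | last => exact absurd hij (lt_irrefl _)
      | cast i => simpa using (m.le_top i).trans_lt h
    | cast j =>
      induction i using Fin.lastCases with
      | last => exact absurd hij (Fin.castSucc_lt_last j).not_gt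
      | cast i => simpa using m.2.2 (Fin.castSucc_lt_castSucc_iff.1 hij)⟩

theorem MPLRange.init_top_lt {r : ℕ} (m : MPLRange (r + 1)) : m.init.top < m.top := by
  cases r with
  | zero => exact m.2.1 _
  | succ r => exact m.2.2 (Fin.castSucc_lt_last _)

theorem MPLRange.init_snoc {r : ℕ} (m : MPLRange r) (n : ℕ) (h : m.top < n) :
    (m.snoc n h).init = m :=
  Subtype.ext (Fin.init_snoc (α := fun _ => ℕ) _ _)

theorem MPLRange.top_snoc {r : ℕ} (m : MPLRange r) (n : ℕ) (h : m.top < n) :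
    (m.snoc n h).top = n :=
  Fin.snoc_last (α := fun _ => ℕ) _ _

theorem MPLRange.snoc_init {r : ℕ} (m : MPLRange (r + 1)) (n : ℕ) (hn : m.top = n)
    (h : m.init.top < n) : m.init.snoc n h = m := by
  subst hn
  exact Subtype.ext (Fin.snoc_init_self (α := fun _ => ℕ) _)

/-- Sequences of length `r + 1` ending in `n` are sequences of length `r` ending below `n`. -/
def MPLRange.topFiberEquiv (r n : ℕ) :
    {m : MPLRange (r + 1) // m.top = n} ≃ Σ j : Fin n, {m : MPLRange r // m.top = j} where
  toFun m := ⟨⟨m.1.init.top, m.1.init_top_lt.trans_eq m.2⟩, ⟨m.1.init, rfl⟩⟩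
  invFun p := ⟨p.2.1.snoc n (p.2.2.trans_lt p.1.2), MPLRange.top_snoc _ _ _⟩
  left_inv m := Subtype.ext (MPLRange.snoc_init m.1 n m.2 (m.1.init_top_lt.trans_eq m.2))
  right_inv p := by
    refine Sigma.subtype_ext (Fin.ext ?_) ?_
    · simp only [MPLRange.init_snoc]
      exact p.2.2
    · exact MPLRange.init_snoc p.2.1 n (p.2.2.trans_lt p.1.2)

instance MPLRange.finite_topFiber (r n : ℕ) : Finite {m : MPLRange r // m.top = n} := by
  induction r generalizing n with
  | zero => infer_instance
  | succ r ih => exact Finite.of_equiv _ (MPLRange.topFiberEquiv r n).symm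

/-! ### Multiple polylogarithms as power series -/

/-- The weight `1 / (m_1 ^ k_1 ⋯ m_r ^ k_r)`. -/
noncomputable def mplWeight {r : ℕ} (k : Fin r → ℕ) (m : MPLRange r) : ℝ :=
  (∏ i, (m.1 i : ℝ) ^ k i)⁻¹

theorem mplWeight_nonneg {r : ℕ} (k : Fin r → ℕ) (m : MPLRange r) : 0 ≤ mplWeight k m := by
  unfold mplWeight
  positivity

theorem mplWeight_snoc {r : ℕ} (k : Fin (r + 1) → ℕ) (m : MPLRange r) (n : ℕ) (h : m.top < n) :
    mplWeight k (m.snoc n h) =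
      mplWeight (fun i => k i.castSucc) m / (n : ℝ) ^ k (Fin.last r) := by
  unfold mplWeight MPLRange.snoc
  rw [Fin.prod_univ_castSucc]
  simp [div_eq_mul_inv, mul_comm]

theorem polylogTerm_eq_weight {r : ℕ} (k : Fin r → ℕ) (z : ℂ) (m : MPLRange r) :
    polylogTerm k z m = (mplWeight k m : ℂ) * z ^ m.top := by
  cases r with
  | zero => simp [polylogTerm, mplTerm, mplWeight, MPLRange.top]
  | succ r =>
    rw [polylogTerm_eq, mplWeight, MPLRange.top, div_eq_mul_inv, mul_comm]
    push_cast
    rfl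

/-- The sum of `1 / (m_1 ^ k_1 ⋯ m_r ^ k_r)` over `0 < m_1 < ⋯ < m_r = n`, as a function of the
reversed list `[k_r, …, k_1]`. -/
noncomputable def multHarmonic : List ℕ → ℕ → ℝ
  | [], n => if n = 0 then 1 else 0
  | k :: L, n => (∑ j ∈ Finset.range n, multHarmonic L j) / (n : ℝ) ^ k

theorem multHarmonic_nonneg (L : List ℕ) (n : ℕ) : 0 ≤ multHarmonic L n := by
  induction L generalizing n with
  | nil => unfold multHarmonic; split_ifs <;> norm_num
  | cons k L ih => exact div_nonneg (Finset.sum_nonneg fun j _ => ih j) (by positivity)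

theorem multHarmonic_le_one (L : List ℕ) (hL : ∀ k ∈ L, 0 < k) (n : ℕ) :
    multHarmonic L n ≤ 1 := by
  induction L generalizing n with
  | nil => unfold multHarmonic; split_ifs <;> norm_num
  | cons k L ih =>
    rcases Nat.eq_zero_or_pos n with rfl | hn
    · simp [multHarmonic]
    have h1 : (1 : ℝ) ≤ n := by exact_mod_cast hn
    refine div_le_one_of_le₀ ?_ (by positivity)
    calc ∑ j ∈ Finset.range n, multHarmonic L j ≤ ∑ _j ∈ Finset.range n, (1 : ℝ) :=
          Finset.sum_le_sum fun j _ => ih (fun k hk => hL k (List.mem_cons_of_mem _ hk)) j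
      _ = (n : ℝ) := by simp
      _ ≤ (n : ℝ) ^ k := le_self_pow₀ h1 (hL k List.mem_cons_self).ne'

/-- Deleting the largest entry matches the recursion of `multHarmonic`; the fibres are finite, so
summability is automatic. -/
theorem hasSum_mplWeight_topFiber {r : ℕ} (k : Fin r → ℕ) (n : ℕ) :
    HasSum (fun m : {m : MPLRange r // m.top = n} => mplWeight k m.1)
      (multHarmonic (List.ofFn k).reverse n) := by
  induction r generalizing n with
  | zero =>
    by_cases hn : n = 0
    · subst hn
      let a : {m : MPLRange 0 // m.top = 0} := ⟨⟨Fin.elim0, fun i => i.elim0, fun i => i.elim0⟩, rfl⟩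
      have : Unique {m : MPLRange 0 // m.top = 0} :=
        ⟨⟨a⟩, fun b => Subtype.ext (Subtype.ext (Subsingleton.elim _ _))⟩
      simpa only [mplWeight, multHarmonic, Finset.univ_eq_empty, Finset.prod_empty, inv_one, if_true, List.ofFn_zero, List.reverse_nil] using
        hasSum_unique (fun m : {m : MPLRange 0 // m.top = 0} => mplWeight k m.1)
    · have : IsEmpty {m : MPLRange 0 // m.top = n} := ⟨fun m => hn m.2.symm⟩
      simp [multHarmonic, hn, hasSum_empty]
  | succ r ih =>
    rw [← (MPLRange.topFiberEquiv r n).symm.hasSum_iff]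
    have h1 : (List.ofFn k).reverse =
        k (Fin.last r) :: (List.ofFn fun i => k (Fin.castSucc i)).reverse := by
      rw [List.ofFn_succ']
      simp
    rw [h1, multHarmonic, ← Fin.sum_univ_eq_sum_range, Finset.sum_div]
    have h2 : ∀ p : Σ j : Fin n, {m : MPLRange r // m.top = j},
        ((fun m : {m : MPLRange (r + 1) // m.top = n} => mplWeight k m.1) ∘
          (MPLRange.topFiberEquiv r n).symm) p =
        mplWeight (fun i => k (Fin.castSucc i)) p.2.1 / (n : ℝ) ^ k (Fin.last r) :=
      fun p => mplWeight_snoc k p.2.1 n (p.2.2.trans_lt p.1.2)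
    rw [funext h2]
    have hs : Summable fun p : Σ j : Fin n, {m : MPLRange r // m.top = j} =>
        mplWeight (fun i => k (Fin.castSucc i)) p.2.1 / (n : ℝ) ^ k (Fin.last r) :=
      Summable.of_finite
    have h3 := hs.hasSum.sigma fun j => (ih (fun i => k (Fin.castSucc i)) j).div_const _
    rw [← h3.unique (hasSum_fintype _)]
    exact hs.hasSum

theorem hasSum_polylogTerm {r : ℕ} (k : Fin r → ℕ) (hk : ∀ i, 0 < k i) (z : ℂ) (hz : ‖z‖ < 1) :
    HasSum (polylogTerm k z) (∑' n, (multHarmonic (List.ofFn k).reverse n : ℂ) * z ^ n) := by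
  set L := (List.ofFn k).reverse with hL
  have hpos : ∀ a ∈ L, 0 < a := by
    intro a ha
    rw [hL, List.mem_reverse, List.mem_ofFn] at ha
    obtain ⟨i, rfl⟩ := ha
    exact hk i
  rw [← (Equiv.sigmaFiberEquiv (MPLRange.top (r := r))).hasSum_iff]
  have h2 : ∀ p : Σ n : ℕ, {m : MPLRange r // m.top = n},
      (polylogTerm k z ∘ Equiv.sigmaFiberEquiv (MPLRange.top (r := r))) p =
      (mplWeight k p.2.1 : ℂ) * z ^ p.1 := by
    rintro ⟨n, m, rfl⟩
    exact polylogTerm_eq_weight k z m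
  rw [funext h2]
  have hs : Summable fun p : Σ n : ℕ, {m : MPLRange r // m.top = n} =>
      (mplWeight k p.2.1 : ℂ) * z ^ p.1 := by
    refine Summable.of_norm ?_
    have h3 : ∀ p : Σ n : ℕ, {m : MPLRange r // m.top = n},
        ‖(mplWeight k p.2.1 : ℂ) * z ^ p.1‖ = mplWeight k p.2.1 * ‖z‖ ^ p.1 := by
      intro p
      rw [norm_mul, norm_pow, Complex.norm_real, Real.norm_of_nonneg (mplWeight_nonneg _ _)]
    simp only [h3]
    have h5 : ∀ n, HasSum (fun m : {m : MPLRange r // m.top = n} => mplWeight k m.1 * ‖z‖ ^ n)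
        (multHarmonic L n * ‖z‖ ^ n) :=
      fun n => (hasSum_mplWeight_topFiber k n).mul_right (‖z‖ ^ n)
    have h6 : ∀ p : Σ n : ℕ, {m : MPLRange r // m.top = n},
        0 ≤ mplWeight k p.2.1 * ‖z‖ ^ p.1 := fun p =>
      mul_nonneg (mplWeight_nonneg k p.2.1) (pow_nonneg (norm_nonneg z) p.1)
    refine (summable_sigma_of_nonneg h6).2 ⟨fun n => (h5 n).summable, ?_⟩
    have h7 : ∀ n, ∑' m : {m : MPLRange r // m.top = n}, mplWeight k m.1 * ‖z‖ ^ n =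
        multHarmonic L n * ‖z‖ ^ n := fun n => (h5 n).tsum_eq
    refine (summable_congr h7).2 ?_
    -- Positive exponents give fibre sums at most 1, so the geometric series in `‖z‖` dominates.
    refine Summable.of_nonneg_of_le
      (fun n => mul_nonneg (multHarmonic_nonneg _ _) (by positivity)) (fun n => ?_)
      (summable_geometric_of_lt_one (norm_nonneg z) hz)
    exact mul_le_of_le_one_left (by positivity) (multHarmonic_le_one L hpos n)
  have h4 : ∀ n, HasSum (fun m : {m : MPLRange r // m.top = n} => (mplWeight k m.1 : ℂ) * z ^ n)
      ((multHarmonic L n : ℂ) * z ^ n) := fun n =>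
    (Complex.hasSum_ofReal.2 (hasSum_mplWeight_topFiber k n)).mul_right (z ^ n)
  rw [(hs.hasSum.sigma h4).tsum_eq]
  exact hs.hasSum

/-! ### Compositions and the Landen coefficients -/

/-- Put a block `1` in front of a composition. -/
def Composition.consOne {n : ℕ} (c : Composition n) : Composition (n + 1) where
  blocks := 1 :: c.blocks
  blocks_pos := by
    intro i hi
    rcases List.mem_cons.1 hi with rfl | hi
    · exact one_pos
    · exact c.blocks_pos hi
  blocks_sum := by rw [List.sum_cons, c.blocks_sum, add_comm]

/-- Increase the first block of a composition by one. -/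
def Composition.succHead {n : ℕ} (c : Composition (n + 1)) : Composition (n + 2) where
  blocks := c.blocks.modifyHead (· + 1)
  blocks_pos := by
    obtain ⟨_ | ⟨a, L⟩, hp, hs⟩ := c
    · simp at hs
    · intro i hi
      rcases List.mem_cons.1 hi with rfl | hi
      · exact Nat.succ_pos _
      · exact hp (List.mem_cons_of_mem _ hi)
  blocks_sum := by
    obtain ⟨_ | ⟨a, L⟩, hp, hs⟩ := c
    · simp at hs
    · simp only [List.modifyHead_cons, List.sum_cons] at hs ⊢
      omega

/-- The first block tells the two constructions apart: it is 1 in one and at least 2 in the other.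
Surjectivity follows by counting, `2 ^ n + 2 ^ n = 2 ^ (n + 1)`. -/
theorem Composition.bijective_consOne_succHead (n : ℕ) : Function.Bijective
    (Sum.elim (fun c : Composition (n + 1) => c.consOne)
      fun c : Composition (n + 1) => c.succHead) := by
  rw [Fintype.bijective_iff_injective_and_card]
  constructor
  · rintro (⟨_ | ⟨a, L⟩, hp, hs⟩ | ⟨_ | ⟨a, L⟩, hp, hs⟩) (⟨_ | ⟨b, M⟩, hp', hs'⟩ | ⟨_ | ⟨b, M⟩, hp', hs'⟩) h <;>
      simp [Composition.consOne, Composition.succHead] at h hs hs' ⊢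
    · exact Composition.ext (by simp [h])
    · exact absurd h.1 (hp' List.mem_cons_self).ne'
    · exact absurd h.1 (hp List.mem_cons_self).ne'
    · exact Composition.ext (by simp [h])
  · rw [Fintype.card_sum, composition_card, composition_card]
    simp
    ring

/-- The iterated averages of `δ_{n,1}`: `landenCoeff k n` is `h_{k-1}(1, 1/2, …, 1/n) / n`. -/
noncomputable def landenCoeff : ℕ → ℕ → ℝ
  | 0, n => if n = 1 then 1 else 0
  | k + 1, n => (∑ j ∈ Finset.range (n + 1), landenCoeff k j) / n

theorem multHarmonic_succHead {n : ℕ} (c : Composition (n + 1)) (N : ℕ) :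
    multHarmonic c.succHead.blocks N = multHarmonic c.blocks N / N := by
  obtain ⟨_ | ⟨a, L⟩, hp, hs⟩ := c
  · simp at hs
  · simp [Composition.succHead, multHarmonic, pow_succ, div_div]

/-- A new block `1` contributes the terms `j < n` of the recursion for `landenCoeff`, and an
enlarged first block the term `j = n`. -/
theorem sum_multHarmonic (k n : ℕ) :
    ∑ c : Composition (k + 1), multHarmonic c.blocks n = landenCoeff (k + 1) n := by
  induction k generalizing n with
  | zero =>
    have h : ∀ c : Composition (0 + 1), multHarmonic c.blocks n = multHarmonic [1] n := by
      intro c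
      have := Composition.eq_single_iff_length (n := 0 + 1) one_pos (c := c)
      rw [this.2 (le_antisymm c.length_le (c.length_pos_iff.2 one_pos)),
        Composition.single_blocks]
    rw [Finset.sum_congr rfl fun c _ => h c, Finset.sum_const, Finset.card_univ,
      composition_card]
    rcases n with _ | n
    · simp [multHarmonic, landenCoeff]
    · simp [multHarmonic, landenCoeff]
  | succ k ih =>
    rw [← (Equiv.ofBijective _ (Composition.bijective_consOne_succHead k)).sum_comp,
      Fintype.sum_sum_type]
    simp only [Equiv.ofBijective_apply, Sum.elim_inl, Sum.elim_inr, multHarmonic_succHead]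
    rw [← Finset.sum_div, ih]
    simp only [Composition.consOne, multHarmonic, pow_one]
    rw [← Finset.sum_div, Finset.sum_comm, ← add_div, Finset.sum_congr rfl fun j _ => ih j,
      ← Finset.sum_range_succ]
    rfl

/-- `multHarmonic` reads exponents from the largest entry down; reversal only permutes the
compositions. -/
theorem sum_multHarmonic_reverse (k n : ℕ) :
    ∑ c : Composition (k + 1), multHarmonic (List.ofFn c.blocksFun).reverse n =
      landenCoeff (k + 1) n := by
  rw [← sum_multHarmonic, ← (Equiv.ofBijective _ Composition.reverse_bijective).sum_comp]
  simp [Composition.reverse, Composition.ofFn_blocksFun]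

theorem landenCoeff_nonneg (k n : ℕ) : 0 ≤ landenCoeff k n := by
  induction k generalizing n with
  | zero => unfold landenCoeff; split_ifs <;> norm_num
  | succ k ih => exact div_nonneg (Finset.sum_nonneg fun j _ => ih j) n.cast_nonneg

@[simp] theorem landenCoeff_at_zero (k : ℕ) : landenCoeff k 0 = 0 := by
  cases k <;> simp [landenCoeff]

@[simp] theorem landenCoeff_at_one (k : ℕ) : landenCoeff k 1 = 1 := by
  induction k with
  | zero => simp [landenCoeff]
  | succ k ih => simp [landenCoeff, Finset.sum_range_succ, ih]

theorem landenCoeff_le_one (k n : ℕ) : landenCoeff k n ≤ 1 := by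
  induction k generalizing n with
  | zero => unfold landenCoeff; split_ifs <;> norm_num
  | succ k ih =>
    refine div_le_one_of_le₀ ?_ n.cast_nonneg
    -- The term `j = 0` vanishes, leaving `n` terms, each at most 1, to divide by `n`.
    rw [Finset.sum_range_succ', landenCoeff_at_zero, add_zero]
    calc ∑ j ∈ Finset.range n, landenCoeff k (j + 1) ≤ ∑ _j ∈ Finset.range n, (1 : ℝ) :=
          Finset.sum_le_sum fun j _ => ih _
      _ = (n : ℝ) := by simp

/-! ### Power series with coefficients in `[0, 1]` -/

theorem summable_mul_pow_of_mem_Icc {a : ℕ → ℝ} (h0 : ∀ n, 0 ≤ a n) (h1 : ∀ n, a n ≤ 1) {z : ℂ}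
    (hz : ‖z‖ < 1) : Summable fun n => (a n : ℂ) * z ^ n := by
  refine Summable.of_norm_bounded (summable_geometric_of_lt_one (norm_nonneg z) hz) fun n => ?_
  rw [norm_mul, norm_pow, Complex.norm_real, Real.norm_of_nonneg (h0 n)]
  exact mul_le_of_le_one_left (by positivity) (h1 n)

theorem summable_natCast_mul_mul_pow {a : ℕ → ℝ} (h0 : ∀ n, 0 ≤ a n) (h1 : ∀ n, a n ≤ 1) {z : ℂ}
    (hz : ‖z‖ < 1) : Summable fun n : ℕ => (n : ℂ) * a n * z ^ n := by
  have hs := summable_pow_mul_geometric_of_norm_lt_one 1 (r := ‖z‖) (by simpa using hz)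
  refine Summable.of_norm_bounded hs fun n => ?_
  rw [norm_mul, norm_mul, norm_pow, Complex.norm_real, Real.norm_of_nonneg (h0 n),
    Complex.norm_natCast, pow_one]
  exact mul_le_mul_of_nonneg_right (mul_le_of_le_one_right n.cast_nonneg (h1 n)) (by positivity)

/-- Termwise differentiation on a ball of radius `r` with `‖z‖ < r < 1`, where `n * r ^ (n - 1)` is
a summable bound. -/
theorem hasDerivAt_tsum_mul_pow {a : ℕ → ℝ} (h0 : ∀ n, 0 ≤ a n) (h1 : ∀ n, a n ≤ 1) {z : ℂ}
    (hz : ‖z‖ < 1) : HasDerivAt (fun w : ℂ => ∑' n, (a n : ℂ) * w ^ n)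
      (∑' n : ℕ, (a n : ℂ) * (n * z ^ (n - 1))) z := by
  obtain ⟨r, hzr, hr⟩ := exists_between hz
  have hr0 : 0 < r := (norm_nonneg z).trans_lt hzr
  have hu : Summable fun n : ℕ => (n : ℝ) * r ^ (n - 1) := by
    have hs := summable_pow_mul_geometric_of_norm_lt_one 1 (r := r)
      (by rwa [Real.norm_of_nonneg hr0.le])
    refine (hs.mul_right r⁻¹).congr fun n => ?_
    rcases n with _ | n
    · simp
    · simp [pow_succ, mul_assoc, hr0.ne']
  refine hasDerivAt_tsum_of_isPreconnected (t := Metric.ball 0 r) (y₀ := 0) hu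
    Metric.isOpen_ball (convex_ball (0 : ℂ) r).isPreconnected
    (fun n y _ => (hasDerivAt_pow n y).const_mul _) (fun n y hy => ?_)
    (Metric.mem_ball_self hr0) (summable_mul_pow_of_mem_Icc h0 h1 (by simp)) (by simpa using hzr)
  rw [mem_ball_zero_iff] at hy
  rw [norm_mul, norm_mul, norm_pow, Complex.norm_real, Real.norm_of_nonneg (h0 n),
    Complex.norm_natCast]
  refine (mul_le_of_le_one_left (by positivity) (h1 n)).trans ?_
  gcongr

theorem mul_tsum_deriv {a : ℕ → ℝ} (z : ℂ) :
    z * ∑' n : ℕ, (a n : ℂ) * (n * z ^ (n - 1)) = ∑' n : ℕ, (n : ℂ) * a n * z ^ n := by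
  rw [← tsum_mul_left]
  refine tsum_congr fun n => ?_
  rcases n with _ | n
  · simp
  · rw [Nat.add_sub_cancel, pow_succ]
    ring

theorem tsum_deriv_at_zero (a : ℕ → ℝ) :
    ∑' n : ℕ, (a n : ℂ) * (n * (0 : ℂ) ^ (n - 1)) = a 1 := by
  rw [tsum_eq_single 1]
  · simp
  · intro n hn
    rcases n with _ | _ | n
    · simp
    · exact absurd rfl hn
    · simp

theorem tsum_mul_pow_at_zero (a : ℕ → ℝ) : ∑' n : ℕ, (a n : ℂ) * (0 : ℂ) ^ n = a 0 := by
  rw [tsum_eq_single 0]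
  · simp
  · intro n hn
    simp [hn]

/-! ### Differential equations of the two series -/

/-- The generating function of the coefficients `landenCoeff k`. -/
noncomputable def landenSeries (k : ℕ) (w : ℂ) : ℂ := ∑' n, (landenCoeff k n : ℂ) * w ^ n

/-- The coefficients `n * landenCoeff (k + 1) n` are partial sums of `landenCoeff k`; multiplying by
`1 - w` takes their differences. -/
theorem one_sub_mul_tsum_landenCoeff (k : ℕ) {w : ℂ} (hw : ‖w‖ < 1) :
    (1 - w) * ∑' n : ℕ, (n : ℂ) * landenCoeff (k + 1) n * w ^ n = landenSeries k w := by
  have hs := summable_natCast_mul_mul_pow (landenCoeff_nonneg (k + 1)) (landenCoeff_le_one (k + 1)) hw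
  have ha := summable_mul_pow_of_mem_Icc (landenCoeff_nonneg k) (landenCoeff_le_one k) hw
  have hc : ∀ n : ℕ, (n : ℂ) * landenCoeff (k + 1) n =
      ((∑ j ∈ Finset.range (n + 1), landenCoeff k j : ℝ) : ℂ) := by
    intro n
    rcases n with _ | n
    · simp
    · rw [landenCoeff]
      push_cast
      rw [mul_div_cancel₀]
      exact_mod_cast n.succ_ne_zero
  have hz : ((0 : ℕ) : ℂ) * landenCoeff (k + 1) 0 * w ^ 0 = 0 := by simp
  rw [sub_mul, one_mul, landenSeries, ha.tsum_eq_zero_add, ← tsum_mul_left, hs.tsum_eq_zero_add,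
    hz, zero_add, ← ((summable_nat_add_iff 1).2 hs).tsum_sub (hs.mul_left w)]
  simp only [landenCoeff_at_zero, Complex.ofReal_zero, zero_mul, zero_add]
  refine tsum_congr fun n => ?_
  rw [hc, hc, Finset.sum_range_succ _ (n + 1), pow_succ]
  push_cast
  ring

/-- The coefficients of the classical polylogarithm. -/
noncomputable def polylogCoeff (k n : ℕ) : ℝ := if n = 0 then 0 else ((n : ℝ) ^ k)⁻¹

theorem polylogCoeff_nonneg (k n : ℕ) : 0 ≤ polylogCoeff k n := by
  unfold polylogCoeff
  split_ifs <;> positivity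

theorem polylogCoeff_le_one (k n : ℕ) : polylogCoeff k n ≤ 1 := by
  unfold polylogCoeff
  split_ifs with h
  · norm_num
  · exact inv_le_one_of_one_le₀ (one_le_pow₀ (by exact_mod_cast Nat.pos_of_ne_zero h))

/-- The classical polylogarithm of order `k ≥ 0`. -/
noncomputable def polylogSeries (k : ℕ) (z : ℂ) : ℂ := ∑' n, (polylogCoeff k n : ℂ) * z ^ n

theorem tsum_natCast_mul_polylogCoeff (k : ℕ) (z : ℂ) :
    ∑' n : ℕ, (n : ℂ) * polylogCoeff (k + 1) n * z ^ n = polylogSeries k z := by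
  refine tsum_congr fun n => ?_
  rcases n with _ | n
  · simp [polylogCoeff]
  · have : ((n : ℂ) + 1) ≠ 0 := by exact_mod_cast n.succ_ne_zero
    simp only [polylogCoeff, n.succ_ne_zero, if_false]
    push_cast
    congr 1
    field_simp
    ring

theorem polylogSeries_zero {z : ℂ} (hz : ‖z‖ < 1) : polylogSeries 0 z = z / (1 - z) := by
  have hs := summable_mul_pow_of_mem_Icc (polylogCoeff_nonneg 0) (polylogCoeff_le_one 0) hz
  rw [polylogSeries, hs.tsum_eq_zero_add]
  simp only [polylogCoeff, Nat.succ_ne_zero, if_false, if_true, pow_zero, inv_one,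
    Complex.ofReal_one, Complex.ofReal_zero, one_mul, zero_mul, zero_add, pow_succ]
  rw [tsum_mul_right, tsum_geometric_of_norm_lt_one hz, mul_comm, div_eq_mul_inv]

theorem landenSeries_zero (w : ℂ) : landenSeries 0 w = w := by
  rw [landenSeries, tsum_eq_single 1]
  · simp
  · intro n hn
    simp [landenCoeff, hn]

/-! ### The substitution and the connection formula -/

theorem ne_one_of_re_lt_half {z : ℂ} (hre : z.re < 1 / 2) : z ≠ 1 := by
  rintro rfl
  norm_num at hre

/-- The half-plane consists of the points closer to 0 than to 1. -/
theorem norm_div_sub_one_lt_one {z : ℂ} (hre : z.re < 1 / 2) : ‖z / (z - 1)‖ < 1 := by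
  have h1 : z - 1 ≠ 0 := sub_ne_zero.2 (ne_one_of_re_lt_half hre)
  rw [norm_div, div_lt_one (norm_pos_iff.2 h1), ← sq_lt_sq₀ (norm_nonneg _) (norm_nonneg _),
    Complex.sq_norm, Complex.sq_norm, Complex.normSq_apply, Complex.normSq_apply]
  simp
  nlinarith

theorem hasDerivAt_div_sub_one {z : ℂ} (hz : z ≠ 1) :
    HasDerivAt (fun z : ℂ => z / (z - 1)) (-1 / (z - 1) ^ 2) z := by
  have h := (hasDerivAt_id z).div ((hasDerivAt_id z).sub_const 1) (sub_ne_zero.2 hz)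
  convert! h using 1
  simp

/-- The Landen connection formula for the generating functions. -/
theorem polylogSeries_add_landenSeries (k : ℕ) {z : ℂ} (hz : ‖z‖ < 1) (hre : z.re < 1 / 2) :
    polylogSeries k z + landenSeries k (z / (z - 1)) = 0 := by
  induction k generalizing z with
  | zero =>
    have h1 : z - 1 ≠ 0 := sub_ne_zero.2 (ne_one_of_re_lt_half hre)
    rw [polylogSeries_zero hz, landenSeries_zero, ← neg_sub z 1, div_neg, neg_add_cancel]
  | succ k ih =>
    let U : Set ℂ := Metric.ball 0 1 ∩ {z | z.re < 1 / 2}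
    have hUo : IsOpen U :=
      Metric.isOpen_ball.inter (isOpen_lt Complex.continuous_re continuous_const)
    have hUc : Convex ℝ U := (convex_ball 0 1).inter (convex_halfSpace_re_lt _)
    have h0U : (0 : ℂ) ∈ U := ⟨Metric.mem_ball_self one_pos, by norm_num⟩
    let D : ℂ → ℂ := fun z => polylogSeries (k + 1) z + landenSeries (k + 1) (z / (z - 1))
    have hD : ∀ x ∈ U, HasDerivAt D 0 x := by
      rintro x ⟨hx, hxre⟩
      rw [mem_ball_zero_iff] at hx
      have hx1 : x - 1 ≠ 0 := sub_ne_zero.2 (ne_one_of_re_lt_half hxre)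
      have hw := norm_div_sub_one_lt_one hxre
      have h1 := hasDerivAt_tsum_mul_pow (polylogCoeff_nonneg (k + 1))
        (polylogCoeff_le_one (k + 1)) hx
      have h2 := hasDerivAt_tsum_mul_pow (landenCoeff_nonneg (k + 1))
        (landenCoeff_le_one (k + 1)) hw
      have h3 := h1.add (h2.comp x (hasDerivAt_div_sub_one (ne_one_of_re_lt_half hxre)))
      convert! h3 using 1
      -- The differential equations control only `x` times the derivative. At `x = 0` the linear
      -- coefficients are both 1 and `w` has derivative `-1`, so they cancel.
      by_cases hx0 : x = 0
      · subst hx0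
        simp only [zero_div]
        rw [tsum_deriv_at_zero, tsum_deriv_at_zero]
        simp [polylogCoeff]
      · refine (mul_left_cancel₀ hx0 ?_).symm
        have e1 := mul_tsum_deriv (a := polylogCoeff (k + 1)) x
        have e2 := mul_tsum_deriv (a := landenCoeff (k + 1)) (x / (x - 1))
        have e3 := one_sub_mul_tsum_landenCoeff k hw
        rw [tsum_natCast_mul_polylogCoeff] at e1
        rw [← e2] at e3
        -- This is `x dw/dx = (1 - w) w`.
        have e4 : x * (-1 / (x - 1) ^ 2) = (1 - x / (x - 1)) * (x / (x - 1)) := by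
          field_simp
          ring
        rw [mul_zero, mul_add, e1, mul_left_comm, e4, ← ih hx hxre, ← e3]
        ring
    have hc := hUo.is_const_of_deriv_eq_zero hUc.isPreconnected
      (fun x hx => (hD x hx).differentiableAt.differentiableWithinAt)
      (fun x hx => (hD x hx).deriv) (show z ∈ U from ⟨by simpa using hz, hre⟩) h0U
    refine hc.trans ?_
    simp only [D, zero_div, polylogSeries, landenSeries, tsum_mul_pow_at_zero]
    simp [polylogCoeff]

/-! ### Return to the multiple polylogarithms -/

theorem multHarmonic_singleton (k n : ℕ) : multHarmonic [k] n = polylogCoeff k n := by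
  rcases n with _ | n
  · simp [multHarmonic, polylogCoeff]
  · simp [multHarmonic, polylogCoeff]

theorem hasSum_polylogTerm_singleton {k : ℕ} (hk : 0 < k) {z : ℂ} (hz : ‖z‖ < 1) :
    HasSum (polylogTerm ![k] z) (polylogSeries k z) := by
  have h := hasSum_polylogTerm ![k] (by simpa using hk) z hz
  simpa [multHarmonic_singleton, polylogSeries] using h

theorem hasSum_polylogTerm_composition {k : ℕ} (c : Composition k) {w : ℂ} (hw : ‖w‖ < 1) :
    HasSum (polylogTerm c.blocksFun w)
      (∑' n, (multHarmonic (List.ofFn c.blocksFun).reverse n : ℂ) * w ^ n) :=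
  hasSum_polylogTerm _ (fun i => c.one_le_blocksFun i) w hw

theorem sum_polylog_composition (k : ℕ) {w : ℂ} (hw : ‖w‖ < 1) :
    ∑ c : Composition (k + 1), polylog c.blocksFun w = landenSeries (k + 1) w := by
  have h : ∀ c : Composition (k + 1), polylog c.blocksFun w =
      ∑' n, (multHarmonic (List.ofFn c.blocksFun).reverse n : ℂ) * w ^ n :=
    fun c => (hasSum_polylogTerm_composition c hw).tsum_eq
  rw [Finset.sum_congr rfl fun c _ => h c, ← Summable.tsum_finsetSum]
  · refine tsum_congr fun n => ?_
    rw [← Finset.sum_mul, ← Complex.ofReal_sum, sum_multHarmonic_reverse]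
  · intro c _
    refine summable_mul_pow_of_mem_Icc (multHarmonic_nonneg _) (multHarmonic_le_one _ ?_) hw
    intro a ha
    rw [c.ofFn_blocksFun, List.mem_reverse] at ha
    exact c.blocks_pos ha

theorem mainTheorem8 (k : ℕ) (hk : 0 < k) (z : ℂ) (hz : ‖z‖ < 1) (hre : z.re < 1 / 2) :
    Summable (polylogTerm ![k] z) ∧
    (∀ c : Composition k, Summable (polylogTerm c.blocksFun (z / (z - 1)))) ∧
    polylog ![k] z = -∑ c : Composition k, polylog c.blocksFun (z / (z - 1)) := by
  have hw := norm_div_sub_one_lt_one hre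
  have h1 := hasSum_polylogTerm_singleton hk hz
  refine ⟨h1.summable, fun c => (hasSum_polylogTerm_composition c hw).summable, ?_⟩
  obtain ⟨k, rfl⟩ := Nat.exists_eq_succ_of_ne_zero hk.ne'
  rw [sum_polylog_composition k hw]
  exact h1.tsum_eq.trans (eq_neg_of_add_eq_zero_left (polylogSeries_add_landenSeries _ hz hre))
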